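/- Let $\delta$ be an inaccessible cardinal (uncountable, regular and strong limit). For a cardinal $\kappa<\delta$ and a set $A\subseteq V_\delta$, say that $\kappa$ is $({<}\delta,A)$-extendible if for every ordinal $\lambda$ with $\kappa<\lambda<\delta$ there are an ordinal $\theta<\delta$ and an elementary embedding $j:\langle V_\lambda,\in,A\cap V_\lambda\rangle\to\langle V_\theta,\in,A\cap V_\theta\rangle$ with critical point $\kappa$ (the least ordinal moved by $j$) and $\lambda<j(\kappa)$. The following are equivalent: 1. $\delta$ is a Vopěnka cardinal: $\delta$ is inaccessible and, for every first-order language $\mathcal L$ of size less than $\delta$ and every set $\mathcal M\subseteq V_\delta$ of $\delta$ many $\mathcal L$-structures, there are structures $M\neq N$ in $\mathcal M$ with an elementary embedding $j:M\to N$. 2. For every $A\subseteq V_\delta$ there is $\lambda_0<\delta$ such that for every ordinal $\lambda$ with $\lambda_0\le\lambda<\delta$ there are an ordinal $\theta$ with $\lambda<\theta<\delta$ and an elementary embedding $j:\langle V_\lambda,\in,A\cap V_\lambda\rangle\to\langle V_\theta,\in,A\cap V_\theta\rangle$. 3. For every $A\subseteq V_\delta$ there is a $({<}\delta,A)$-extendible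 cardinal $\kappa<\delta$. 4. For every $A\subseteq V_\delta$ the set of $({<}\delta,A)$-extendible cardinals $\kappa<\delta$ is stationary in $\delta$, i.e. it meets every closed unbounded subset of $\delta$. -/

import Mathlib

open Cardinal FirstOrder
open scoped ZFSet

universe u

/-- The relation symbols of the first-order language of set theory with one additional
unary predicate. -/
inductive SetPredRel : ℕ → Type
  | mem : SetPredRel 2
  | pred : SetPredRel 1

/-- The first-order language with a binary relation symbol (membership) and a unary predicate
symbol. -/
def setPredLanguage : FirstOrder.Language.{0, 0} := ⟨fun _ => Empty, SetPredRel⟩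

/-- The domain of the structure `⟨V_α, ∈, A ∩ V_α⟩`. -/
def Cut (_A : ZFSet.{u}) (α : Ordinal.{u}) : Type (u + 1) := {x : ZFSet.{u} // x ∈ V_ α}

/-- The structure `⟨V_α, ∈, A ∩ V_α⟩`. -/
instance Cut.instStructure (A : ZFSet.{u}) (α : Ordinal.{u}) :
    setPredLanguage.Structure (Cut A α) where
  funMap := fun f => nomatch f
  RelMap
    | .mem => fun x => (x 0).1 ∈ (x 1).1
    | .pred => fun x => (x 0).1 ∈ A ∩ V_ α

/-- An ordinal `κ < α`, regarded as an element of `V_α`. -/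
noncomputable def Cut.ord (A : ZFSet.{u}) {κ α : Ordinal.{u}} (h : κ < α) : Cut A α :=
  ⟨κ.toZFSet, ZFSet.mem_vonNeumann.2 (by rwa [Ordinal.rank_toZFSet])⟩

/-- For `κ < α`, the embedding `j : ⟨V_α, ∈, A ∩ V_α⟩ → ⟨V_θ, ∈, A ∩ V_θ⟩` has critical point `κ`,
that is, `κ` is the least ordinal moved by `j`. -/
def HasCriticalPoint {A : ZFSet.{u}} {α θ : Ordinal.{u}}
    (j : Cut A α ↪ₑ[setPredLanguage] Cut A θ) {κ : Ordinal.{u}} (hκ : κ < α) : Prop :=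
  (j (Cut.ord A hκ)).1 ≠ κ.toZFSet ∧
    ∀ (β : Ordinal.{u}) (hβ : β < κ), (j (Cut.ord A (hβ.trans hκ))).1 = β.toZFSet

/-- `κ` is a `(<δ, A)`-extendible cardinal: a cardinal `κ < δ` such that for every ordinal `lam`
with `κ < lam < δ` there are `θ < δ` and an elementary embedding
`j : ⟨V_lam, ∈, A ∩ V_lam⟩ → ⟨V_θ, ∈, A ∩ V_θ⟩` with critical point `κ` and `lam < j(κ)`. -/
def IsExtendibleBelow (δ : Cardinal.{u}) (A : ZFSet.{u}) (κ : Ordinal.{u}) : Prop :=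
  κ.IsInitial ∧ κ < δ.ord ∧
    ∀ (lam : Ordinal.{u}) (hκ : κ < lam), lam < δ.ord →
      ∃ θ < δ.ord, ∃ j : Cut A lam ↪ₑ[setPredLanguage] Cut A θ,
        HasCriticalPoint j hκ ∧ lam.toZFSet ∈ (j (Cut.ord A hκ)).1

/-- A first-order `L`-structure whose domain is a nonempty set in the cumulative hierarchy. -/
structure SetStructure (L : FirstOrder.Language.{u, u}) where
  /-- The domain of the structure. -/
  carrier : ZFSet.{u}
  nonempty : carrier.Nonempty
  /-- The interpretation of the symbols of `L`. -/
  str : L.Structure {x : ZFSet.{u} // x ∈ carrier}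

/-- The underlying type of a set-sized structure. -/
def SetStructure.Dom {L : FirstOrder.Language.{u, u}} (M : SetStructure L) : Type (u + 1) :=
  {x : ZFSet.{u} // x ∈ M.carrier}

instance SetStructure.instStructure {L : FirstOrder.Language.{u, u}} (M : SetStructure L) :
    L.Structure M.Dom := M.str

/-- `δ` is a Vopěnka cardinal: `δ` is inaccessible and, for every first-order language `L` with
fewer than `δ` symbols and every set `S` of exactly `δ` many `L`-structures in `V_δ`, there are
two distinct members of `S` with an elementary embedding of the first into the second.
As `δ` is inaccessible and `L` has fewer than `δ` symbols (which may be taken to lie in `V_δ`),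
an `L`-structure belongs to `V_δ` exactly when its domain does. -/
def IsVopenkaCardinal (δ : Cardinal.{u}) : Prop :=
  δ.IsInaccessible ∧
    ∀ L : FirstOrder.Language.{u, u}, L.card < δ →
      ∀ S : Set (SetStructure L), (∀ M ∈ S, M.carrier ∈ V_ δ.ord) →
        #S = Cardinal.lift.{u + 1} δ →
          ∃ M ∈ S, ∃ N ∈ S, M ≠ N ∧ Nonempty (M.Dom ↪ₑ[L] N.Dom)

/-! The cycle is 1 → 4 → 3 → 2 → 1. A stationary set is nonempty, and λ < j(κ) ∈ V_θ gives λ < θ, so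
4 → 3 → 2 is easy. The other two steps pass through `HasUnboundedEmbeddings`. It follows from 1 by
applying the Vopěnka property to the structures ⟨V_α, ∈, A ∩ V_α⟩ with α ∈ E, and from 2 because E
is unbounded.

These embeddings come with no control over the critical point κ. As in Kunen's inconsistency
argument, control comes from ω-Jónsson functions coded into A. Suppose η < κ < g η and j preserves
an ω-Jónsson function on g η. Then that function puts κ into the range of j on the ordinals, which
is impossible for a critical point. So κ is closed under g; being a closure point is coded as well,
so κ' = j(κ) is one too (`HasUnboundedEmbeddings.exists_preservesSets`). The functions exist at
strong limits of cofinality ω, which are unbounded in δ.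

Coding also the satisfaction relation of a δ-sequence of structures M i makes j restrict to an
elementary embedding of M κ into M κ' (`HasUnboundedEmbeddings.exists_elementaryEmbedding`). For
arbitrary structures this gives 1. For M i = V_(f i), where f i witnesses that i is not extendible,
closure of κ' gives f κ < κ' = j(κ), which contradicts the choice of f κ. Closure of κ also places
it in any prescribed club, which gives 4. -/

/-! ### Existence of ω-Jónsson functions -/

theorem exists_injective_choice {ι β : Type u} (T : ι → Set β) (hT : ∀ i, #ι ≤ #(T i)) :
    ∃ s : ι → β, Function.Injective s ∧ ∀ i, s i ∈ T i := by
  obtain ⟨r, hwo, hr⟩ := Cardinal.exists_ord_eq ι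
  have hstep : ∀ (i : ι) (f : ∀ j, r j i → β), ∃ b ∈ T i, ∀ j (h : r j i), f j h ≠ b := by
    intro i f
    by_contra! hcon
    have h1 : #(T i) ≤ #{j // r j i} := by
      have : T i ⊆ Set.range (fun j : {j // r j i} => f j.1 j.2) := by
        intro b hb
        obtain ⟨j, h, hj⟩ := hcon b hb
        exact ⟨⟨j, h⟩, hj⟩
      exact (mk_le_mk_of_subset this).trans mk_range_le
    -- The well-order has the least order type of its cardinality, so fewer than `#ι` values have
    -- been used before stage `i`.
    have h2 : #{j // r j i} < #ι := by
      have := Ordinal.typein_lt_type r i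
      rw [← hr, Cardinal.lt_ord] at this
      exact this
    exact absurd (hT i) (not_le.2 (h1.trans_lt h2))
  choose F hF1 hF2 using hstep
  let s : ι → β := hwo.wf.fix F
  have hs : ∀ i, s i = F i (fun j _ => s j) := fun i => hwo.wf.fix_eq F i
  refine ⟨s, ?_, fun i => hs i ▸ hF1 i _⟩
  have hne : ∀ i j, r j i → s j ≠ s i := by
    intro i j h
    rw [hs i]
    exact hF2 i (fun j _ => s j) j h
  intro i j hij
  rcases trichotomous_of r i j with h | h | h
  · exact absurd hij (hne j i h)
  · exact h
  · exact absurd hij.symm (hne i j h)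

/-- There are at most 2^|Γ| pairs (X, ξ) with X ⊆ Γ of full size, and each X carries |Γ|^ℵ₀ ≥ 2^|Γ|
sequences. So distinct pairs can be given distinct sequences s(X, ξ) in X, and F sends s(X, ξ) to ξ.
The range of an injection is one of the sets X. -/
theorem exists_omega_jonsson_type (Γ : Type u) [Infinite Γ] (hΓ : 2 ^ #Γ ≤ #Γ ^ ℵ₀) :
    ∃ F : (ℕ → Γ) → Γ, ∀ h : Γ → Γ, Function.Injective h → ∀ ξ, ∃ t : ℕ → Γ, F (h ∘ t) = ξ := by
  classical
  let ι := {X : Set Γ // #X = #Γ} × Γ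
  have hι : #ι ≤ 2 ^ #Γ := by
    have h1 : #{X : Set Γ // #X = #Γ} ≤ 2 ^ #Γ := by
      rw [← mk_set]; exact mk_subtype_le _
    calc #ι = #{X : Set Γ // #X = #Γ} * #Γ := by simp [ι]
      _ ≤ 2 ^ #Γ * 2 ^ #Γ := mul_le_mul' h1 (cantor _).le
      _ = 2 ^ #Γ := mul_eq_self ((aleph0_le_mk Γ).trans (cantor _).le)
  obtain ⟨s, hs, hsT⟩ := exists_injective_choice (ι := ι) (β := ℕ → Γ)
    (fun i => {t | ∀ n, t n ∈ i.1.1}) (by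
      rintro ⟨⟨X, hX⟩, ξ⟩
      have : #{t : ℕ → Γ | ∀ n, t n ∈ X} = #(ℕ → X) :=
        mk_congr ⟨fun t n => ⟨t.1 n, t.2 n⟩, fun t => ⟨fun n => t n, fun n => (t n).2⟩,
          fun _ => rfl, fun _ => rfl⟩
      rw [this]
      calc #ι ≤ #Γ ^ ℵ₀ := hι.trans hΓ
        _ = #(ℕ → X) := by simp [hX])
  refine ⟨fun t => if h : ∃ i, s i = t then h.choose.2 else t 0, fun h hh ξ => ?_⟩
  let i : ι := (⟨Set.range h, mk_range_eq h hh⟩, ξ)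
  choose t ht using hsT i
  refine ⟨t, ?_⟩
  have e : h ∘ t = s i := funext ht
  have hex : ∃ j, s j = h ∘ t := ⟨i, e.symm⟩
  simp only [dif_pos hex]
  rw [hs (hex.choose_spec.trans e)]

/-- The cardinal is the sum of the iterated powers of c, a strong limit of cofinality ω. -/
theorem exists_two_power_le_power_aleph0 {δ : Cardinal.{u}} (hδ : δ.IsInaccessible)
    {c : Cardinal.{u}} (hc : c < δ) :
    ∃ d, c < d ∧ d < δ ∧ ℵ₀ ≤ d ∧ 2 ^ d ≤ d ^ (ℵ₀ : Cardinal.{u}) := by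
  let T : ℕ → Type u := fun n => Nat.rec (c.out) (fun _ X => Set X) n
  have hT : ∀ n, #(T n) < δ := by
    intro n
    induction n with
    | zero => simpa [T] using hc
    | succ n ih =>
      have : #(T (n + 1)) = 2 ^ #(T n) := mk_set
      rw [this]; exact hδ.isStrongPrelimit ih
  let Γ := Σ n, T n
  have hne : ∀ n, Nonempty (T (n + 1)) := fun n => ⟨(Set.univ : Set (T n))⟩
  have hle : ∀ n, #(T n) ≤ #Γ := fun n => mk_le_of_injective (f := fun x : T n => (⟨n, x⟩ : Γ))
    sigma_mk_injective
  refine ⟨#Γ, ?_, ?_, ?_, ?_⟩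
  · refine lt_of_lt_of_le ?_ (hle 1)
    have : #(T 1) = 2 ^ #(T 0) := mk_set
    rw [this]
    simpa [T] using cantor c
  · have : #Γ = Cardinal.sum (fun n => #(T n)) := mk_sigma _
    rw [this]
    exact sum_lt_lift_of_isRegular (ι := ℕ) hδ.isRegular (by simpa using hδ.aleph0_lt) hT
  · have : Function.Injective (fun n : ℕ => (⟨n + 1, (hne n).some⟩ : Γ)) := fun a b h => by
      simpa using congrArg Sigma.fst h
    simpa [-mk_sigma] using lift_mk_le_lift_mk_of_injective this
  -- A subset of Γ is determined by the sequence of its traces on the `T n`; the trace on `T n` is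
  -- an element of `T (n + 1)`.
  · have h1 : Function.Injective
        (fun (X : Set Γ) (n : ℕ) => (⟨n + 1, ({x | (⟨n, x⟩ : Γ) ∈ X} : Set (T n))⟩ : Γ)) := by
      intro X Y h
      ext ⟨n, x⟩
      have := congrFun h n
      simp only [Sigma.mk.injEq, heq_eq_eq, true_and] at this
      exact Set.ext_iff.1 this x
    have h2 := mk_le_of_injective h1
    simpa [-mk_sigma] using h2

/-- `F` is an `ω`-Jónsson function for the ordinal `γ`: for every one-to-one `h` from `γ` to `γ`,
every ordinal below `γ` is a value of `F` at an `ω`-sequence with entries in the range of `h`. -/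
def IsOmegaJonsson (γ : Ordinal.{u}) (F : (ℕ → Ordinal.{u}) → Ordinal.{u}) : Prop :=
  (∀ t, (∀ n, t n < γ) → F t < γ) ∧
    ∀ h : Ordinal.{u} → Ordinal.{u}, Set.InjOn h (Set.Iio γ) → Set.MapsTo h (Set.Iio γ) (Set.Iio γ) →
      ∀ ξ < γ, ∃ t : ℕ → Ordinal.{u}, (∀ n, t n < γ) ∧ F (h ∘ t) = ξ

theorem exists_isOmegaJonsson {d : Cardinal.{u}} (hd : ℵ₀ ≤ d)
    (h2 : 2 ^ d ≤ d ^ (ℵ₀ : Cardinal.{u})) : ∃ F, IsOmegaJonsson d.ord F := by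
  classical
  let e : Set.Iio d.ord ≃ d.ord.ToType := (Ordinal.ToType.mk (o := d.ord)).toEquiv
  have hcard : #d.ord.ToType = d := mk_ord_toType d
  have : Infinite d.ord.ToType := by rw [infinite_iff, hcard]; exact hd
  obtain ⟨F, hF⟩ := exists_omega_jonsson_type d.ord.ToType (by rw [hcard]; exact h2)
  let F' : (ℕ → Ordinal.{u}) → Ordinal.{u} := fun t =>
    if h : ∀ n, t n < d.ord then (e.symm (F fun n => e ⟨t n, h n⟩)).1 else 0
  refine ⟨F', fun t ht => ?_, fun h hinj hmaps ξ hξ => ?_⟩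
  · simp only [F', dif_pos ht]
    exact (e.symm _).2
  · let h' : d.ord.ToType → d.ord.ToType := fun x => e ⟨h (e.symm x).1, hmaps (e.symm x).2⟩
    obtain ⟨t, ht⟩ := hF h' (by
      intro x y hxy
      have := hinj (e.symm x).2 (e.symm y).2 (by simpa [h'] using hxy)
      exact e.symm.injective (Subtype.ext this)) (e ⟨ξ, hξ⟩)
    refine ⟨fun n => (e.symm (t n)).1, fun n => (e.symm (t n)).2, ?_⟩
    have hlt : ∀ n, (h ∘ fun n => (e.symm (t n)).1) n < d.ord := fun n => hmaps (e.symm (t n)).2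
    simp only [F', dif_pos hlt]
    have : (fun n => e ⟨(h ∘ fun n => (e.symm (t n)).1) n, hlt n⟩) = h' ∘ t := rfl
    rw [this, ht]; simp

/-! ### Set-theoretic facts preserved by elementary embeddings -/

/-- The membership symbol. -/
def memSymbol : setPredLanguage.Relations 2 := SetPredRel.mem

/-- The symbol of the additional predicate. -/
def predSymbol : setPredLanguage.Relations 1 := SetPredRel.pred

/-- The atomic formula `s ∈ t`. -/
def memFormula {α : Type*} {n : ℕ} (s t : setPredLanguage.Term (α ⊕ Fin n)) :
    setPredLanguage.BoundedFormula α n :=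
  memSymbol.boundedFormula₂ s t

/-- The atomic formula saying that the predicate holds of `t`. -/
def predFormula {α : Type*} {n : ℕ} (t : setPredLanguage.Term (α ⊕ Fin n)) :
    setPredLanguage.BoundedFormula α n :=
  predSymbol.boundedFormula₁ t

section Realize

variable {A : ZFSet.{u}} {o : Ordinal.{u}} {α : Type*} {n : ℕ}

theorem realize_memFormula {s t : setPredLanguage.Term (α ⊕ Fin n)} {v : α → Cut A o}
    {xs : Fin n → Cut A o} : (memFormula s t).Realize v xs ↔
      (s.realize (Sum.elim v xs)).1 ∈ (t.realize (Sum.elim v xs)).1 := by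
  rw [memFormula, Language.BoundedFormula.realize_rel₂]
  rfl

theorem realize_predFormula {t : setPredLanguage.Term (α ⊕ Fin n)} {v : α → Cut A o}
    {xs : Fin n → Cut A o} : (predFormula t).Realize v xs ↔
      (t.realize (Sum.elim v xs)).1 ∈ A := by
  rw [predFormula, Language.BoundedFormula.realize_rel₁]
  refine ZFSet.mem_inter.trans (and_iff_left ?_)
  exact (t.realize (Sum.elim v xs)).2

end Realize

theorem Ordinal.toZFSet_mem_vonNeumann {α β : Ordinal.{u}} : α.toZFSet ∈ V_ β ↔ α < β := by
  rw [ZFSet.mem_vonNeumann, Ordinal.rank_toZFSet]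

theorem ZFSet.mem_vonNeumann_of_mem {x y : ZFSet.{u}} {α : Ordinal.{u}} (hx : x ∈ y)
    (hy : y ∈ V_ α) : x ∈ V_ α :=
  (ZFSet.isTransitive_vonNeumann α).mem_trans hx hy

/-- The properties of an elementary embedding `⟨V_α, ∈, A ∩ V_α⟩ → ⟨V_θ, ∈, A ∩ V_θ⟩`, regarded as
a map on sets, that are used below. -/
structure PreservesSets (A : ZFSet.{u}) (α θ : Ordinal.{u}) (J : ZFSet.{u} → ZFSet.{u}) : Prop where
  maps : ∀ {x}, x ∈ V_ α → J x ∈ V_ θ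
  mem_iff : ∀ {x y}, x ∈ V_ α → y ∈ V_ α → (J x ∈ J y ↔ x ∈ y)
  inj : ∀ {x y}, x ∈ V_ α → y ∈ V_ α → J x = J y → x = y
  pred : ∀ {x}, x ∈ V_ α → (J x ∈ A ↔ x ∈ A)
  empty : (∅ : ZFSet.{u}) ∈ V_ α → J ∅ = ∅
  upair : ∀ {x y : ZFSet.{u}}, {x, y} ∈ V_ α → J {x, y} = {J x, J y}
  succ : ∀ {x : ZFSet.{u}}, insert x x ∈ V_ α → J (insert x x) = insert (J x) (J x)
  max : ∀ {x}, x ∈ V_ α → (∀ y ∈ V_ α, x ∉ y) → ∀ y ∈ V_ θ, J x ∉ y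

theorem snoc_default_zero {M : Type*} (a : M) : (Fin.snoc default a : Fin 1 → M) 0 = a := rfl

open FirstOrder.Language in
theorem preservesSets_of_elementary {A : ZFSet.{u}} {α θ : Ordinal.{u}} {J : ZFSet.{u} → ZFSet.{u}}
    (j : Cut A α ↪ₑ[setPredLanguage] Cut A θ) (hJ : ∀ x : Cut A α, J x.1 = (j x).1) :
    PreservesSets A α θ J := by
  have maps : ∀ {x}, x ∈ V_ α → J x ∈ V_ θ := fun {x} hx => by
    rw [hJ ⟨x, hx⟩]; exact (j ⟨x, hx⟩).2
  have hj : ∀ x (hx : x ∈ V_ α), j ⟨x, hx⟩ = ⟨J x, maps hx⟩ := fun x hx =>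
    Subtype.ext (hJ ⟨x, hx⟩).symm
  have key : ∀ {m : ℕ} (φ : setPredLanguage.Formula (Fin m)) (x : Fin m → Cut A α),
      φ.Realize (j ∘ x) ↔ φ.Realize x := fun φ x => j.map_formula φ x
  have hsub : ∀ {β : Ordinal.{u}} {p : Cut A β → Prop}, (∀ a, p a) ↔ ∀ y (h : y ∈ V_ β), p ⟨y, h⟩ :=
    ⟨fun h y hy => h ⟨y, hy⟩, fun h a => h a.1 a.2⟩
  refine ⟨maps, fun {x y} hx hy => ?_, fun {x y} hx hy h => ?_, fun {x} hx => ?_, fun h => ?_,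
    fun {x y} h => ?_, fun {x} h => ?_, fun {x} hx h => ?_⟩
  · have := key (memFormula (var (Sum.inl 0)) (var (Sum.inl 1))) ![⟨x, hx⟩, ⟨y, hy⟩]
    simpa [Formula.Realize, realize_memFormula, hj] using this
  · rw [hJ ⟨x, hx⟩, hJ ⟨y, hy⟩] at h
    exact congrArg Subtype.val (j.injective (Subtype.ext h))
  · have := key (predFormula (var (Sum.inl 0))) ![⟨x, hx⟩]
    simpa [Formula.Realize, realize_predFormula, hj] using this
  · have := (key (∀' ∼(memFormula (&0) (var (Sum.inl 0)))) ![⟨∅, h⟩]).2 (by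
      simp [Formula.Realize, realize_memFormula])
    simp [Formula.Realize, realize_memFormula, snoc_default_zero, hsub, hj] at this
    exact (ZFSet.eq_empty _).2 fun w hw => this w (ZFSet.mem_vonNeumann_of_mem hw (maps h)) hw
  · have hx : x ∈ V_ α := ZFSet.mem_vonNeumann_of_mem (by simp) h
    have hy : y ∈ V_ α := ZFSet.mem_vonNeumann_of_mem (by simp) h
    have := (key (∀' ((memFormula (&0) (var (Sum.inl 2))) ⇔
        ((&0 =' (var (Sum.inl 0))) ⊔ (&0 =' (var (Sum.inl 1))))))
       ![⟨x, hx⟩, ⟨y, hy⟩, ⟨_, h⟩]).2 (by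
      simp [Formula.Realize, realize_memFormula, snoc_default_zero, hsub]
      exact fun _ _ => or_congr Subtype.mk_eq_mk.symm Subtype.mk_eq_mk.symm)
    simp [Formula.Realize, realize_memFormula, snoc_default_zero, hsub, hj] at this
    replace this := fun w hw => (this w hw).trans (or_congr Subtype.mk_eq_mk Subtype.mk_eq_mk)
    ext w
    rw [ZFSet.mem_pair]
    refine ⟨fun hw => (this w (ZFSet.mem_vonNeumann_of_mem hw (maps h))).1 hw, ?_⟩
    rintro (rfl | rfl)
    · exact (this _ (maps hx)).2 (Or.inl rfl)
    · exact (this _ (maps hy)).2 (Or.inr rfl)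
  · have hx : x ∈ V_ α := ZFSet.mem_vonNeumann_of_mem (by simp) h
    have := (key (∀' ((memFormula (&0) (var (Sum.inl 1))) ⇔
        ((&0 =' (var (Sum.inl 0))) ⊔ (memFormula (&0) (var (Sum.inl 0))))))
       ![⟨x, hx⟩, ⟨_, h⟩]).2 (by
      simp [Formula.Realize, realize_memFormula, snoc_default_zero, hsub]
      exact fun _ _ => or_congr Subtype.mk_eq_mk.symm Iff.rfl)
    simp [Formula.Realize, realize_memFormula, snoc_default_zero, hsub, hj] at this
    replace this := fun w hw => (this w hw).trans (or_congr Subtype.mk_eq_mk Iff.rfl)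
    ext w
    rw [ZFSet.mem_insert_iff]
    refine ⟨fun hw => (this w (ZFSet.mem_vonNeumann_of_mem hw (maps h))).1 hw, ?_⟩
    rintro (rfl | hw)
    · exact (this _ (maps hx)).2 (Or.inl rfl)
    · exact (this _ (ZFSet.mem_vonNeumann_of_mem hw (maps hx))).2 (Or.inr hw)
  · have := (key (∀' ∼(memFormula (var (Sum.inl 0)) (&0))) ![⟨x, hx⟩]).2 (by
      simpa [Formula.Realize, realize_memFormula, snoc_default_zero, hsub] using h)
    simpa [Formula.Realize, realize_memFormula, snoc_default_zero, hsub, hj] using this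

namespace PreservesSets

variable {A : ZFSet.{u}} {α θ : Ordinal.{u}} {J : ZFSet.{u} → ZFSet.{u}}

theorem pair (h : PreservesSets A α θ J) {x y : ZFSet.{u}} (hxy : ZFSet.pair x y ∈ V_ α) :
    J (ZFSet.pair x y) = ZFSet.pair (J x) (J y) := by
  have h1 : ({x} : ZFSet.{u}) ∈ V_ α := ZFSet.mem_vonNeumann_of_mem (by simp [ZFSet.pair]) hxy
  have h2 : ({x, y} : ZFSet.{u}) ∈ V_ α := ZFSet.mem_vonNeumann_of_mem (by simp [ZFSet.pair]) hxy
  have h3 : J {x} = {J x} := by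
    rw [← ZFSet.pair_eq_singleton] at h1 ⊢
    rw [h.upair h1, ZFSet.pair_eq_singleton]
  rw [ZFSet.pair, h.upair hxy, h3, h.upair h2, ZFSet.pair]

theorem rank_le (h : PreservesSets A α θ J) (x : ZFSet.{u}) (hx : x ∈ V_ α) :
    x.rank ≤ (J x).rank := by
  induction x using ZFSet.inductionOn with
  | _ x ih =>
    refine ZFSet.rank_le_iff.2 fun y hy => ?_
    have hyα := ZFSet.mem_vonNeumann_of_mem hy hx
    exact (ih y hy hyα).trans_lt (ZFSet.rank_lt_of_mem ((h.mem_iff hyα hx).2 hy))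

theorem le (h : PreservesSets A α θ J) : α ≤ θ := by
  by_contra! hlt
  have h1 := h.rank_le θ.toZFSet (Ordinal.toZFSet_mem_vonNeumann.2 hlt)
  rw [Ordinal.rank_toZFSet] at h1
  exact absurd (ZFSet.mem_vonNeumann.1 (h.maps (Ordinal.toZFSet_mem_vonNeumann.2 hlt))) h1.not_gt

theorem add_natCast (h : PreservesSets A α θ J) {β : Ordinal.{u}}
    (hβ : J β.toZFSet = β.toZFSet) (n : ℕ) (hn : β + n < α) :
    J (β + n).toZFSet = (β + n).toZFSet := by
  induction n with
  | zero => simpa using hβ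
  | succ n ih =>
    have hn' := Ordinal.toZFSet_mem_vonNeumann.2 hn
    rw [Nat.cast_succ, ← add_assoc] at hn hn' ⊢
    rw [Ordinal.toZFSet_add_one] at hn' ⊢
    rw [h.succ hn', ih ((Order.lt_add_one_iff.2 le_rfl).trans hn)]

theorem natCast (h : PreservesSets A α θ J) (n : ℕ) (hn : (n : Ordinal.{u}) < α) :
    J (n : Ordinal.{u}).toZFSet = (n : Ordinal.{u}).toZFSet := by
  have h0 : J (0 : Ordinal.{u}).toZFSet = (0 : Ordinal.{u}).toZFSet := by
    rw [Ordinal.toZFSet_zero]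
    refine h.empty ?_
    rw [← Ordinal.toZFSet_zero]
    exact Ordinal.toZFSet_mem_vonNeumann.2 (pos_of_gt hn)
  simpa using h.add_natCast h0 n (by simpa using hn)

/-- The largest ordinal of V_(α+1) belongs to no element of that level, and its image inherits this
in V_θ; but there α belongs to α + 1. -/
theorem ne_of_succ (h : PreservesSets A (α + 1) θ J) (hθ : α + 1 < θ) :
    J α.toZFSet ≠ α.toZFSet := by
  intro he
  have hα : α < α + 1 := Order.lt_add_one_iff.2 le_rfl
  have := h.max (Ordinal.toZFSet_mem_vonNeumann.2 hα) (fun y hy hmem => by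
    have := ZFSet.rank_lt_of_mem hmem
    rw [Ordinal.rank_toZFSet] at this
    exact absurd (ZFSet.mem_vonNeumann.1 hy) (Order.add_one_le_of_lt this).not_gt)
    (α + 1).toZFSet (Ordinal.toZFSet_mem_vonNeumann.2 hθ)
  rw [he] at this
  exact this (Ordinal.toZFSet_mem_toZFSet_iff.2 hα)

end PreservesSets

/-! ### Coding of lists and sequences, and the Kunen argument -/

theorem ZFSet.pair_mem_vonNeumann {x y : ZFSet.{u}} {α : Ordinal.{u}} {n : ℕ}
    (hx : x ∈ V_ (α + n)) (hy : y ∈ V_ (α + n)) : ZFSet.pair x y ∈ V_ (α + (n + 2 : ℕ)) := by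
  rw [ZFSet.mem_vonNeumann] at *
  rw [ZFSet.pair, ZFSet.rank_pair, ZFSet.rank_pair, ZFSet.rank_singleton]
  have h : α + ((n + 2 : ℕ) : Ordinal.{u}) = Order.succ (Order.succ (α + n)) := by
    rw [Order.succ_eq_add_one, Order.succ_eq_add_one, add_assoc, add_assoc, one_add_one_eq_two]
    push_cast
    rfl
  rw [h]
  simp [hx, hy]

theorem ZFSet.pair_mem_vonNeumann_of_isSuccLimit {x y : ZFSet.{u}} {α : Ordinal.{u}}
    (hα : Order.IsSuccLimit α) (hx : x ∈ V_ α) (hy : y ∈ V_ α) : ZFSet.pair x y ∈ V_ α := by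
  rw [ZFSet.mem_vonNeumann] at *
  rw [ZFSet.pair, ZFSet.rank_pair, ZFSet.rank_pair, ZFSet.rank_singleton]
  exact max_lt (hα.succ_lt (hα.succ_lt hx))
    (hα.succ_lt (max_lt (hα.succ_lt hx) (hα.succ_lt hy)))

theorem ZFSet.mem_vonNeumann_of_pair_mem {x y : ZFSet.{u}} {α : Ordinal.{u}}
    (h : ZFSet.pair x y ∈ V_ α) : x ∈ V_ α ∧ y ∈ V_ α := by
  have h2 : ({x, y} : ZFSet.{u}) ∈ V_ α := ZFSet.mem_vonNeumann_of_mem (by simp [ZFSet.pair]) h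
  exact ⟨ZFSet.mem_vonNeumann_of_mem (by simp) h2, ZFSet.mem_vonNeumann_of_mem (by simp) h2⟩

/-- The set coding a finite list of sets. -/
def listCode : List ZFSet.{u} → ZFSet.{u}
  | [] => ∅
  | x :: l => ZFSet.pair x (listCode l)

theorem listCode_inj : ∀ {l l' : List ZFSet.{u}}, l.length = l'.length → listCode l = listCode l' →
    l = l'
  | [], [], _, _ => rfl
  | x :: l, y :: l', hl, h => by
    rw [listCode, listCode, ZFSet.pair_inj] at h
    rw [h.1, listCode_inj (by simpa using hl) h.2]

theorem listCode_mem_vonNeumann {α : Ordinal.{u}} (hα : Order.IsSuccLimit α) :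
    ∀ {l : List ZFSet.{u}}, (∀ x ∈ l, x ∈ V_ α) → listCode l ∈ V_ α
  | [], _ => by
    rw [listCode, ZFSet.mem_vonNeumann, ZFSet.rank_empty]; exact hα.bot_lt
  | x :: l, h => ZFSet.pair_mem_vonNeumann_of_isSuccLimit hα (h x (by simp))
      (listCode_mem_vonNeumann hα fun y hy => h y (by simp [hy]))

/-- The set coding an `ω`-sequence of ordinals. -/
noncomputable def seqCode (t : ℕ → Ordinal.{u}) : ZFSet.{u} :=
  ZFSet.range fun n : ℕ => ZFSet.pair (n : Ordinal.{u}).toZFSet (t n).toZFSet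

theorem pair_mem_seqCode {t : ℕ → Ordinal.{u}} {n : ℕ} {x : ZFSet.{u}} :
    ZFSet.pair (n : Ordinal.{u}).toZFSet x ∈ seqCode t ↔ x = (t n).toZFSet := by
  rw [seqCode, ZFSet.mem_range]
  constructor
  · rintro ⟨m, hm⟩
    rw [ZFSet.pair_inj] at hm
    have := Ordinal.toZFSet_injective hm.1
    rw [Nat.cast_inj] at this
    rw [← hm.2, this]
  · rintro rfl
    exact ⟨n, rfl⟩

theorem seqCode_mem_vonNeumann {α : Ordinal.{u}} (hα : Order.IsSuccLimit α) {t : ℕ → Ordinal.{u}}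
    (ht : ∀ n, t n < α) : seqCode t ∈ V_ (α + 1) := by
  rw [ZFSet.mem_vonNeumann, Order.lt_add_one_iff, ZFSet.rank_le_iff]
  intro y hy
  obtain ⟨n, rfl⟩ := ZFSet.mem_range.1 hy
  exact ZFSet.mem_vonNeumann.1 (ZFSet.pair_mem_vonNeumann_of_isSuccLimit hα
    (Ordinal.toZFSet_mem_vonNeumann.2 (Ordinal.natCast_lt_of_isSuccLimit hα n))
    (Ordinal.toZFSet_mem_vonNeumann.2 (ht n)))

namespace PreservesSets

variable {A : ZFSet.{u}} {α θ : Ordinal.{u}} {J : ZFSet.{u} → ZFSet.{u}}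

theorem listCode (h : PreservesSets A α θ J) :
    ∀ {l : List ZFSet.{u}}, listCode l ∈ V_ α → J (listCode l) = _root_.listCode (l.map J)
  | [], hl => h.empty hl
  | x :: l, hl => by
    rw [_root_.listCode] at hl ⊢
    rw [h.pair hl, h.listCode (ZFSet.mem_vonNeumann_of_pair_mem hl).2]
    rfl

/-- A critical point is not below an ordinal with a preserved `ω`-Jónsson function. -/
theorem le_of_isOmegaJonsson (h : PreservesSets A α θ J) {γ κ : Ordinal.{u}}
    (hγ : Order.IsSuccLimit γ) (hγα : γ < α)
    {F : (ℕ → Ordinal.{u}) → Ordinal.{u}} (hF : IsOmegaJonsson γ F)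
    (hmaps : ∀ x < γ, ∃ y < γ, J x.toZFSet = y.toZFSet)
    (hseq : ∀ t, (∀ n, t n < γ) → ∃ s, (∀ n, s n < γ) ∧ J (seqCode t) = seqCode s ∧
      J (F t).toZFSet = (F s).toZFSet)
    (hfix : ∀ β < κ, J β.toZFSet = β.toZFSet) (hκ : J κ.toZFSet ≠ κ.toZFSet) : γ ≤ κ := by
  by_contra! hlt
  have hin : ∀ x < γ, x.toZFSet ∈ V_ α := fun x hx =>
    Ordinal.toZFSet_mem_vonNeumann.2 (hx.trans hγα)
  have hrank : ∀ x < γ, (J x.toZFSet).rank < γ ∧ J x.toZFSet = (J x.toZFSet).rank.toZFSet := by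
    intro x hx
    obtain ⟨y, hy, e⟩ := hmaps x hx
    rw [e, Ordinal.rank_toZFSet]
    exact ⟨hy, rfl⟩
  -- `J` induces an injection of γ into itself, so κ is a value of `F` at the image of some sequence
  -- `t`.
  obtain ⟨t, ht, htκ⟩ := hF.2 (fun x => (J x.toZFSet).rank) (by
    intro x hx y hy hxy
    refine Ordinal.toZFSet_injective (h.inj (hin x hx) (hin y hy) ?_)
    rw [(hrank x hx).2, (hrank y hy).2]
    exact congrArg _ hxy) (fun x hx => (hrank x hx).1) κ hlt
  obtain ⟨s, hs, hts, hFs⟩ := hseq t ht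
  have htα : seqCode t ∈ V_ α := ZFSet.vonNeumann_subset_of_le (Order.add_one_le_of_lt hγα)
    (seqCode_mem_vonNeumann hγ ht)
  -- Natural numbers are fixed, so the image of the code of `t` is the code of the termwise image.
  have hst : s = (fun x => (J x.toZFSet).rank) ∘ t := by
    funext n
    have hmem : ZFSet.pair (n : Ordinal.{u}).toZFSet (t n).toZFSet ∈ seqCode t :=
      pair_mem_seqCode.2 rfl
    have hpα := ZFSet.mem_vonNeumann_of_mem hmem htα
    have h1 := (h.mem_iff hpα htα).2 hmem
    rw [hts, h.pair hpα, h.natCast n ((Ordinal.natCast_lt_of_isSuccLimit hγ n).trans hγα),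
      pair_mem_seqCode] at h1
    simp [h1, Ordinal.rank_toZFSet]
  rw [hst, htκ] at hFs
  have hFt := hF.1 t ht
  have hle := h.rank_le _ (hin _ hFt)
  rw [hFs, Ordinal.rank_toZFSet, Ordinal.rank_toZFSet] at hle
  -- Now J(F t) = κ with F t ≤ κ. Ordinals below κ are fixed and κ is moved, so neither case can
  -- occur.
  rcases hle.lt_or_eq with hl | hl
  · rw [hfix _ hl] at hFs
    exact hl.ne (Ordinal.toZFSet_injective hFs)
  · rw [hl] at hFs
    exact hκ hFs

end PreservesSets

/-! ### Embeddings whose critical point is a closure point -/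

theorem Cardinal.IsInaccessible.exists_isOmegaJonsson {δ : Cardinal.{u}} (hδ : δ.IsInaccessible)
    {o : Ordinal.{u}} (ho : o < δ.ord) :
    ∃ γ, o < γ ∧ γ < δ.ord ∧ Order.IsSuccLimit γ ∧ γ.IsInitial ∧ ∃ F, IsOmegaJonsson γ F := by
  obtain ⟨d, hd1, hd2, hd3, hd4⟩ := exists_two_power_le_power_aleph0 hδ (Cardinal.lt_ord.1 ho)
  exact ⟨d.ord, Cardinal.lt_ord.2 hd1, Cardinal.ord_lt_ord.2 hd2, Cardinal.isSuccLimit_ord hd3,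
    Ordinal.isInitial_ord d, _root_.exists_isOmegaJonsson hd3 hd4⟩

theorem Cardinal.IsRegular.exists_bound {δ : Cardinal.{u}} (hδ : δ.IsRegular)
    {g : Ordinal.{u} → Ordinal.{u}} (hg : ∀ η < δ.ord, g η < δ.ord) {α : Ordinal.{u}}
    (hα : α < δ.ord) : ∃ b < δ.ord, ∀ η < α, g η ≤ b := by
  let f : α.ToType → Ordinal.{u} := fun i => g (Ordinal.ToType.mk.symm i).1
  refine ⟨⨆ i, f i, Ordinal.iSup_lt_of_lt_cof (by rw [mk_toType, hδ.cof_ord]; exact Cardinal.lt_ord.1 hα)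
    fun i => hg _ ((Ordinal.ToType.mk.symm i).2.trans hα), fun η hη => ?_⟩
  have := Ordinal.le_iSup f (Ordinal.ToType.mk ⟨η, hη⟩)
  simpa [f] using this

/-- For every `A ⊆ V_δ` and every unbounded `E ⊆ δ` there is an elementary embedding of
`⟨V_α, ∈, A ∩ V_α⟩`, for some `α ∈ E`, into a properly larger `⟨V_θ, ∈, A ∩ V_θ⟩`. -/
def HasUnboundedEmbeddings (δ : Cardinal.{u}) : Prop :=
  ∀ A : ZFSet.{u}, A ⊆ V_ δ.ord → ∀ E : Set Ordinal.{u},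
    (∀ β < δ.ord, ∃ α ∈ E, β ≤ α ∧ α < δ.ord) →
      ∃ α ∈ E, ∃ θ, α < θ ∧ θ < δ.ord ∧ Nonempty (Cut A α ↪ₑ[setPredLanguage] Cut A θ)

/-- The set of the members of `V_δ` of the form `⟨n, x⟩` with `Q n x`. -/
noncomputable def taggedSet (δ : Ordinal.{u}) (Q : ℕ → ZFSet.{u} → Prop) : ZFSet.{u} :=
  ZFSet.sep (fun z => ∃ (n : ℕ) (x : ZFSet.{u}), z = ZFSet.pair (n : Ordinal.{u}).toZFSet x ∧ Q n x)
    (V_ δ)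

theorem pair_mem_taggedSet {δ : Ordinal.{u}} {Q : ℕ → ZFSet.{u} → Prop} {n : ℕ} {x : ZFSet.{u}}
    (h : ZFSet.pair (n : Ordinal.{u}).toZFSet x ∈ V_ δ) :
    ZFSet.pair (n : Ordinal.{u}).toZFSet x ∈ taggedSet δ Q ↔ Q n x := by
  rw [taggedSet, ZFSet.mem_sep, and_iff_right h]
  constructor
  · rintro ⟨m, y, he, hQ⟩
    rw [ZFSet.pair_inj] at he
    obtain rfl := Nat.cast_injective (Ordinal.toZFSet_injective he.1)
    rwa [he.2]
  · exact fun hQ => ⟨n, x, rfl, hQ⟩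

/-- Numerical tags are fixed by `J`, so a single predicate carries several relations at once. -/
theorem PreservesSets.taggedSet_iff {δ α θ : Ordinal.{u}} {Q : ℕ → ZFSet.{u} → Prop}
    {J : ZFSet.{u} → ZFSet.{u}} (h : PreservesSets (taggedSet δ Q) α θ J) (hα : α ≤ δ) (hθ : θ ≤ δ)
    {n : ℕ} {x : ZFSet.{u}} (hx : ZFSet.pair (n : Ordinal.{u}).toZFSet x ∈ V_ α) :
    Q n (J x) ↔ Q n x := by
  have hn := h.natCast n
    (Ordinal.toZFSet_mem_vonNeumann.1 (ZFSet.mem_vonNeumann_of_pair_mem hx).1)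
  have := h.pred hx
  have hJ := h.maps hx
  rw [h.pair hx, hn] at this hJ
  rwa [pair_mem_taggedSet (ZFSet.vonNeumann_subset_of_le hα hx),
    pair_mem_taggedSet (ZFSet.vonNeumann_subset_of_le hθ hJ)] at this

/-- The relations coded into a predicate on `V_δ`: the `ω`-Jónsson functions `F η` on the ordinals
`g η`, these ordinals themselves, their closure points, a relation `Sat`, and the function `b`. -/
def CodedRelation (δ : Ordinal.{u}) (g b : Ordinal.{u} → Ordinal.{u})
    (F : Ordinal.{u} → (ℕ → Ordinal.{u}) → Ordinal.{u}) (Sat : Ordinal.{u} → ZFSet.{u} → Prop) :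
    ℕ → ZFSet.{u} → Prop
  | 0, z => ∃ η < δ, ∃ t : ℕ → Ordinal.{u}, (∀ n, t n < g η) ∧
      z = ZFSet.pair η.toZFSet (ZFSet.pair (seqCode t) (F η t).toZFSet)
  | 1, z => ∃ η < δ, ∃ x < g η, z = ZFSet.pair η.toZFSet x.toZFSet
  | 2, z => ∃ κ < δ, (∀ η < κ, g η ≤ κ) ∧ z = κ.toZFSet
  | 3, z => ∃ i < δ, ∃ w, Sat i w ∧ z = ZFSet.pair i.toZFSet w
  | 4, z => ∃ α < δ, z = ZFSet.pair α.toZFSet (b α).toZFSet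
  | _, _ => False

theorem add_natCast_lt_of_isSuccLimit {α β : Ordinal.{u}} (hα : Order.IsSuccLimit α) (hβ : β < α)
    (n : ℕ) : β + n < α := by
  induction n with
  | zero => simpa using hβ
  | succ n ih =>
    rw [Nat.cast_succ, ← add_assoc]
    exact hα.succ_lt ih

/-- The critical point of an embedding given by `HasUnboundedEmbeddings` may be taken to be a
closure point of any given function, together with its image. -/
theorem HasUnboundedEmbeddings.exists_preservesSets {δ : Cardinal.{u}}
    (hP : HasUnboundedEmbeddings δ) (hδ : δ.IsInaccessible) (G : Ordinal.{u} → Ordinal.{u})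
    (hG : ∀ η < δ.ord, G η < δ.ord) (Sat : Ordinal.{u} → ZFSet.{u} → Prop) :
    ∃ (A : ZFSet.{u}) (lam μ θ : Ordinal.{u}) (J : ZFSet.{u} → ZFSet.{u}) (κ κ' : Ordinal.{u}),
      PreservesSets A lam θ J ∧ Order.IsSuccLimit μ ∧ μ ≤ lam ∧ 0 < κ ∧ κ < κ' ∧ κ' < δ.ord ∧
      J κ.toZFSet = κ'.toZFSet ∧ (∀ β < κ, J β.toZFSet = β.toZFSet) ∧ G κ < μ ∧ κ < μ ∧
      (∀ η < κ, G η < κ) ∧ (∀ η < κ', G η < κ') ∧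
      ∀ w ∈ V_ μ, (Sat κ' (J w) ↔ Sat κ w) := by
  have hlim : Order.IsSuccLimit δ.ord := Cardinal.isSuccLimit_ord hδ.aleph0_lt.le
  have hg : ∀ η, ∃ γ F, η < δ.ord → (η < γ ∧ G η < γ ∧ γ < δ.ord ∧ Order.IsSuccLimit γ ∧
      IsOmegaJonsson γ F) := by
    intro η
    by_cases hη : η < δ.ord
    · obtain ⟨γ, h1, h2, h3, -, F, h4⟩ := hδ.exists_isOmegaJonsson (max_lt hη (hG η hη))
      exact ⟨γ, F, fun _ => ⟨(le_max_left _ _).trans_lt h1, (le_max_right _ _).trans_lt h1, h2, h3,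
        h4⟩⟩
    · exact ⟨0, fun _ => 0, fun h => absurd h hη⟩
  choose g F hgF using hg
  have hb : ∀ α, ∃ b, α < δ.ord → (b < δ.ord ∧ Order.IsSuccLimit b ∧ ∀ η ≤ α, g η < b) := by
    intro α
    by_cases hα : α < δ.ord
    · obtain ⟨b, hb1, hb2⟩ := hδ.isRegular.exists_bound (fun η hη => (hgF η hη).2.2.1)
        (hlim.succ_lt hα)
      obtain ⟨γ, h1, h2, h3, -⟩ := hδ.exists_isOmegaJonsson hb1
      exact ⟨γ, fun _ => ⟨h2, h3, fun η hη => (hb2 η (Order.lt_succ_iff.2 hη)).trans_lt h1⟩⟩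
    · exact ⟨0, fun h => absurd h hα⟩
  choose b hb using hb
  let Q := CodedRelation δ.ord g b F Sat
  -- A successor level has a largest ordinal, here b α + 9. Each ordered pair costs two ranks, and
  -- nine levels above b α hold all the tagged tuples used below.
  let E : Set Ordinal.{u} := {x | ∃ α < δ.ord, x = b α + (9 : ℕ) + 1}
  have hE : ∀ α < δ.ord, b α + (9 : ℕ) + 1 < δ.ord := fun α hα =>
    hlim.succ_lt (add_natCast_lt_of_isSuccLimit hlim (hb α hα).1 9)
  obtain ⟨_, ⟨α, hα, rfl⟩, θ, hθ1, hθ2, ⟨j⟩⟩ := hP (taggedSet δ.ord Q) ZFSet.sep_subset E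
    (fun β hβ => ⟨_, ⟨β, hβ, rfl⟩, ((((hgF β hβ).1.trans ((hb β hβ).2.2 β le_rfl)).le.trans
      (le_self_add)).trans le_self_add), hE β hβ⟩)
  set μ := b α with hμ
  obtain ⟨hμδ, hμlim, hμg⟩ := hb α hα
  set lam := μ + (9 : ℕ) + 1 with hlam
  classical
  obtain ⟨J, h⟩ : ∃ J, PreservesSets (taggedSet δ.ord Q) lam θ J :=
    ⟨fun x => if h : x ∈ V_ lam then (j ⟨x, h⟩).1 else ∅,
      preservesSets_of_elementary j fun x => dif_pos x.2⟩
  have hμlam : μ ≤ lam := le_self_add.trans le_self_add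
  have hsub : ∀ {n : ℕ} {x : ZFSet.{u}}, n ≤ 9 → x ∈ V_ (μ + n) → x ∈ V_ lam := by
    intro n x hn hx
    refine ZFSet.vonNeumann_subset_of_le (le_trans ?_ le_self_add) hx
    gcongr
  have hord : ∀ {β : Ordinal.{u}}, β ≤ μ → β.toZFSet ∈ V_ (μ + (1 : ℕ)) := fun hβ =>
    Ordinal.toZFSet_mem_vonNeumann.2 (by simpa using Order.lt_add_one_iff.2 hβ)
  have hup : ∀ {x : ZFSet.{u}} {m n : ℕ}, m ≤ n → x ∈ V_ (μ + m) → x ∈ V_ (μ + n) :=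
    fun hmn hx => ZFSet.vonNeumann_subset_of_le (by gcongr) hx
  have hnat : ∀ n : ℕ, (n : Ordinal.{u}).toZFSet ∈ V_ (μ + (1 : ℕ)) := fun n =>
    hord (Ordinal.natCast_lt_of_isSuccLimit hμlim n).le
  have hpair2 : ∀ {x y : ZFSet.{u}} {n : ℕ}, 1 ≤ n → x ∈ V_ (μ + (1 : ℕ)) → y ∈ V_ (μ + n) →
      ZFSet.pair x y ∈ V_ (μ + (n + 2 : ℕ)) := fun hn hx hy =>
    ZFSet.pair_mem_vonNeumann (hup hn hx) hy
  have htr : ∀ {n m : ℕ} {x : ZFSet.{u}}, 1 ≤ m → m ≤ 7 → x ∈ V_ (μ + m) → (Q n (J x) ↔ Q n x) :=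
    fun {n m x} hm1 hm7 hx => h.taggedSet_iff (hE α hα).le hθ2.le
      (hsub (by omega) (hpair2 hm1 (hnat n) hx))
  have hαμ : α < μ := (hgF α hα).1.trans (hμg α le_rfl)
  -- If α were fixed, the coded function b would fix μ = b α, hence also the top ordinal μ + 9,
  -- which `PreservesSets.ne_of_succ` forbids. This bounds the critical point by α.
  have hJα : J α.toZFSet ≠ α.toZFSet := by
    intro he
    have h1 : ZFSet.pair α.toZFSet μ.toZFSet ∈ V_ (μ + (3 : ℕ)) :=
      hpair2 le_rfl (hord hαμ.le) (hord le_rfl)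
    have h2 : Q 4 (J (ZFSet.pair α.toZFSet μ.toZFSet)) :=
      (htr (by norm_num) (by norm_num) h1).2 ⟨α, hα, rfl⟩
    rw [h.pair (hsub (by norm_num) h1), he] at h2
    obtain ⟨α', hα', e⟩ := h2
    rw [ZFSet.pair_inj] at e
    obtain rfl := Ordinal.toZFSet_injective e.1
    exact h.ne_of_succ hθ1 (h.add_natCast e.2 9 (Order.lt_add_one_iff.2 le_rfl))
  obtain ⟨κ, hκ, hmin⟩ := WellFounded.has_min Ordinal.lt_wf {x : Ordinal.{u} | J x.toZFSet ≠ x.toZFSet}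
    ⟨α, hJα⟩
  have hκα : κ ≤ α := not_lt.1 (hmin α hJα)
  have hκδ : κ < δ.ord := hκα.trans_lt hα
  have hfix : ∀ β < κ, J β.toZFSet = β.toZFSet := fun β hβ => by
    by_contra hne
    exact hmin β hne hβ
  have hκ0 : 0 < κ := by
    rw [pos_iff_ne_zero]
    rintro rfl
    exact hκ (by simpa using h.natCast 0 (by simpa using pos_of_gt (hαμ.trans_le hμlam)))
  have hclosed : ∀ η < κ, g η ≤ κ := by
    intro η hη
    have hηα : η ≤ α := hη.le.trans hκα
    have hηδ : η < δ.ord := hη.trans hκδ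
    have hημ : η ≤ μ := hηα.trans hαμ.le
    obtain ⟨-, -, -, hγ, hJF⟩ := hgF η hηδ
    have hgμ : g η < μ := hμg η hηα
    refine h.le_of_isOmegaJonsson hγ (hgμ.trans_le hμlam) hJF ?_ ?_ hfix hκ
    · intro x hx
      have h1 : ZFSet.pair η.toZFSet x.toZFSet ∈ V_ (μ + (3 : ℕ)) :=
        hpair2 le_rfl (hord hημ) (hord (hx.trans hgμ).le)
      have h2 : Q 1 (J (ZFSet.pair η.toZFSet x.toZFSet)) :=
        (htr (by norm_num) (by norm_num) h1).2 ⟨η, hηδ, x, hx, rfl⟩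
      rw [h.pair (hsub (by norm_num) h1), hfix η hη] at h2
      obtain ⟨η', hη', y, hy, e⟩ := h2
      rw [ZFSet.pair_inj] at e
      obtain rfl := Ordinal.toZFSet_injective e.1
      exact ⟨y, hy, e.2⟩
    · intro t ht
      have hs : seqCode t ∈ V_ (μ + (1 : ℕ)) := by
        simpa using seqCode_mem_vonNeumann hμlim fun n => (ht n).trans hgμ
      have h0 : ZFSet.pair (seqCode t) (F η t).toZFSet ∈ V_ (μ + (3 : ℕ)) :=
        hpair2 le_rfl hs (hord ((hJF.1 t ht).trans hgμ).le)
      have h1 := hpair2 (by norm_num) (hord hημ) h0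
      have h2 : Q 0 (J (ZFSet.pair η.toZFSet (ZFSet.pair (seqCode t) (F η t).toZFSet))) :=
        (htr (by norm_num) (by norm_num) h1).2 ⟨η, hηδ, t, ht, rfl⟩
      rw [h.pair (hsub (by norm_num) h1), hfix η hη, h.pair (hsub (by norm_num) h0)] at h2
      obtain ⟨η', hη', s, hs, e⟩ := h2
      rw [ZFSet.pair_inj, ZFSet.pair_inj] at e
      obtain rfl := Ordinal.toZFSet_injective e.1
      exact ⟨s, hs, e.2⟩
  have hκμ : κ < μ := hκα.trans_lt hαμ
  -- Relation 2 codes the closure points of g, so the image of κ is again such an ordinal.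
  obtain ⟨κ', hκ'δ, hκ'closed, hJκ⟩ : Q 2 (J κ.toZFSet) :=
    (htr le_rfl (by norm_num) (hord hκμ.le)).2 ⟨κ, hκδ, hclosed, rfl⟩
  have hκκ' : κ < κ' := by
    have := h.rank_le _ (hsub (by norm_num) (hord hκμ.le))
    rw [hJκ, Ordinal.rank_toZFSet, Ordinal.rank_toZFSet] at this
    refine this.lt_of_ne ?_
    rintro rfl
    exact hκ hJκ
  refine ⟨_, lam, μ, θ, J, κ, κ', h, hμlim, hμlam, hκ0, hκκ', hκ'δ, hJκ, hfix,
    (hgF κ hκδ).2.1.trans (hμg κ hκα), hκμ,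
    fun η hη => (hgF η (hη.trans hκδ)).2.1.trans_le (hclosed η hη),
    fun η hη => (hgF η (hη.trans hκ'δ)).2.1.trans_le (hκ'closed η hη), fun w hw => ?_⟩
  have hw' : w ∈ V_ (μ + (1 : ℕ)) := ZFSet.vonNeumann_subset_of_le le_self_add hw
  have h1 := hpair2 le_rfl (hord hκμ.le) hw'
  have h2 := htr (n := 3) (by norm_num) (by norm_num) h1
  rw [h.pair (hsub (by norm_num) h1), hJκ] at h2
  have hQ : ∀ i < δ.ord, ∀ x, Q 3 (ZFSet.pair i.toZFSet x) ↔ Sat i x := by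
    intro i hi x
    constructor
    · rintro ⟨i', hi', w, hs, e⟩
      rw [ZFSet.pair_inj] at e
      obtain rfl := Ordinal.toZFSet_injective e.1
      rwa [e.2]
    · exact fun hs => ⟨i, hi, x, hs, rfl⟩
  rwa [hQ _ hκ'δ, hQ _ hκδ] at h2

/-! ### Embeddings between members of a sequence of structures -/

/-- Given a sequence of structures in `V_δ`, there is an elementary embedding between two of them
that comes from an elementary embedding between levels of the cumulative hierarchy. -/
theorem HasUnboundedEmbeddings.exists_elementaryEmbedding {δ : Cardinal.{u}}
    (hP : HasUnboundedEmbeddings δ) (hδ : δ.IsInaccessible) {L : FirstOrder.Language}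
    (c : (Σ n, L.Formula (Fin n)) → Ordinal.{u}) (hc : Function.Injective c)
    {γ : Ordinal.{u}} (hγ : γ < δ.ord) (hcγ : ∀ φ, c φ < γ)
    (M : Ordinal.{u} → ZFSet.{u}) [∀ i, L.Structure {x // x ∈ M i}]
    (hM : ∀ i < δ.ord, M i ∈ V_ δ.ord)
    (G : Ordinal.{u} → Ordinal.{u}) (hG : ∀ η < δ.ord, G η < δ.ord) :
    ∃ κ κ' : Ordinal.{u}, 0 < κ ∧ κ < κ' ∧ κ' < δ.ord ∧ (∀ η < κ, G η < κ) ∧ (∀ η < κ', G η < κ') ∧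
      ∃ e : {x // x ∈ M κ} ↪ₑ[L] {x // x ∈ M κ'},
        (∀ β < κ, ∀ h : β.toZFSet ∈ M κ, (e ⟨_, h⟩).1 = β.toZFSet) ∧
        ∀ h : κ.toZFSet ∈ M κ, (e ⟨_, h⟩).1 = κ'.toZFSet := by
  let code : ∀ (n : ℕ), L.Formula (Fin n) → (Fin n → ZFSet.{u}) → ZFSet.{u} := fun n φ a =>
    ZFSet.pair (c ⟨n, φ⟩).toZFSet (listCode (List.ofFn a))
  have code_inj : ∀ {n m φ ψ a b}, code n φ a = code m ψ b →
      (⟨n, φ, a⟩ : Σ n, L.Formula (Fin n) × (Fin n → ZFSet.{u})) = ⟨m, ψ, b⟩ := by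
    intro n m φ ψ a b e
    rw [ZFSet.pair_inj] at e
    have := hc (Ordinal.toZFSet_injective e.1)
    obtain rfl : n = m := congrArg Sigma.fst this
    obtain rfl : φ = ψ := by simpa using this
    have := List.ofFn_injective (listCode_inj (by simp) e.2)
    rw [this]
  let Sat : Ordinal.{u} → ZFSet.{u} → Prop := fun i w =>
    ∃ (n : ℕ) (φ : L.Formula (Fin n)) (a : Fin n → {x // x ∈ M i}), φ.Realize a ∧
      w = code n φ (fun k => (a k).1)
  have hSat : ∀ {i n φ} {a : Fin n → ZFSet.{u}}, Sat i (code n φ a) ↔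
      ∃ ha : ∀ k, a k ∈ M i, φ.Realize (fun k => (⟨a k, ha k⟩ : {x // x ∈ M i})) := by
    intro i n φ a
    constructor
    · rintro ⟨m, ψ, b, hb, e⟩
      have := code_inj e
      obtain rfl : n = m := congrArg Sigma.fst this
      simp only [Sigma.mk.injEq, heq_eq_eq, Prod.mk.injEq, true_and] at this
      obtain ⟨rfl, rfl⟩ := this
      exact ⟨fun k => (b k).2, hb⟩
    · rintro ⟨ha, h⟩
      exact ⟨n, φ, _, h, rfl⟩
  obtain ⟨A, lam, μ, θ, J, κ, κ', h, hμ, hμlam, hκ0, hκκ', hκ'δ, hJκ, hfix, hGμ, hκμ, hGκ, hGκ', htr⟩ :=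
    -- Closure of κ under the constant γ makes all formula codes fixed points; the rank term puts `M
    -- κ` inside V_μ, where satisfaction is transferred.
    hP.exists_preservesSets hδ (fun η => max (G η) (max γ (M η).rank)) (fun η hη =>
      max_lt (hG η hη) (max_lt hγ (ZFSet.mem_vonNeumann.1 (hM η hη)))) Sat
  have hMμ : ∀ x ∈ M κ, x ∈ V_ μ := fun x hx => ZFSet.mem_vonNeumann_of_mem hx
    (ZFSet.mem_vonNeumann.2 (((le_max_right _ _).trans (le_max_right _ _)).trans_lt hGμ))
  have hγκ : γ < κ := ((le_max_left _ _).trans (le_max_right _ _)).trans_lt (hGκ 0 hκ0)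
  have key : ∀ {n φ} {a : Fin n → ZFSet.{u}}, (∀ k, a k ∈ M κ) →
      (Sat κ' (code n φ (J ∘ a)) ↔ Sat κ (code n φ a)) := by
    intro n φ a ha
    have hl : listCode (List.ofFn a) ∈ V_ μ := listCode_mem_vonNeumann hμ fun x hx => by
      obtain ⟨k, rfl⟩ := (List.mem_ofFn' _ _).1 hx
      exact hMμ _ (ha k)
    have hcκ := (hcγ ⟨n, φ⟩).trans hγκ
    have hcode : code n φ a ∈ V_ μ := ZFSet.pair_mem_vonNeumann_of_isSuccLimit hμ
      (Ordinal.toZFSet_mem_vonNeumann.2 (hcκ.trans hκμ)) hl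
    have hsub := ZFSet.vonNeumann_subset_of_le hμlam
    have hJ : J (code n φ a) = code n φ (J ∘ a) := by
      simp only [code]
      rw [h.pair (hsub hcode), hfix _ hcκ, h.listCode (hsub hl), List.map_ofFn]
    rw [← htr _ hcode, hJ]
  have hmaps : ∀ x ∈ M κ, J x ∈ M κ' := by
    intro x hx
    -- Satisfaction of ⊤ by an element expresses just that it lies in the domain.
    have := (key (n := 1) (φ := ⊤) (a := fun _ => x) fun _ => hx).2
      (hSat.2 ⟨fun _ => hx, by simp⟩)
    exact (hSat.1 this).1 0
  refine ⟨κ, κ', hκ0, hκκ', hκ'δ, fun η hη => (le_max_left _ _).trans_lt (hGκ η hη),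
    fun η hη => (le_max_left _ _).trans_lt (hGκ' η hη),
    ⟨fun x => ⟨J x.1, hmaps x.1 x.2⟩, fun n φ a => ?_⟩, fun β hβ _ => hfix β hβ, fun _ => hJκ⟩
  have := key (φ := φ) (a := fun k => (a k).1) fun k => (a k).2
  rw [hSat, hSat] at this
  constructor
  · exact fun hr => (this.1 ⟨fun k => hmaps _ (a k).2, hr⟩).2
  · exact fun hr => (this.2 ⟨fun k => (a k).2, hr⟩).2

/-! ### The Vopěnka property from unbounded embeddings -/

theorem mk_formula_lt {L : FirstOrder.Language.{u, u}} {δ : Cardinal.{u}} (hδ : δ.IsInaccessible)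
    (hL : L.card < δ) : #(Σ n, L.Formula (Fin n)) < δ := by
  rw [mk_sigma]
  refine sum_lt_lift_of_isRegular hδ.isRegular (by simpa using hδ.aleph0_lt) fun n => ?_
  have h1 : #(L.Formula (Fin n)) ≤ #(Σ m, L.BoundedFormula (Fin n) m) :=
    mk_le_of_injective (f := Sigma.mk (β := fun m => L.BoundedFormula (Fin n) m) 0)
      sigma_mk_injective
  refine (h1.trans Language.BoundedFormula.card_le).trans_lt (max_lt hδ.aleph0_lt ?_)
  refine add_lt_of_lt hδ.aleph0_lt.le ?_ (by simpa using hL)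
  simpa using hδ.nat_lt n

theorem exists_injective_ordinal_lt (T : Type u) :
    ∃ c : T → Ordinal.{u}, Function.Injective c ∧ ∀ x, c x < (#T).ord := by
  obtain ⟨e⟩ : Nonempty (T ≃ (#T).ord.ToType) := Cardinal.eq.1 (mk_ord_toType _).symm
  exact ⟨fun x => (Ordinal.ToType.mk.symm (e x)).1,
    fun x y h => e.injective (Ordinal.ToType.mk.symm.injective (Subtype.ext h)),
    fun x => (Ordinal.ToType.mk.symm (e x)).2⟩

theorem HasUnboundedEmbeddings.isVopenkaCardinal {δ : Cardinal.{u}}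
    (hP : HasUnboundedEmbeddings δ) (hδ : δ.IsInaccessible) : IsVopenkaCardinal δ := by
  refine ⟨hδ, fun L hL S hS hcard => ?_⟩
  obtain ⟨c, hc, hcγ⟩ := exists_injective_ordinal_lt (Σ n, L.Formula (Fin n))
  obtain ⟨e⟩ : Nonempty (Set.Iio δ.ord ≃ S) := by
    refine Cardinal.eq.1 ?_
    rw [mk_Iio_ordinal, card_ord, hcard]
  have h0 : (0 : Ordinal.{u}) < δ.ord := hδ.isRegular.ord_pos
  classical
  let f : Ordinal.{u} → SetStructure L := fun o =>
    if h : o < δ.ord then (e ⟨o, h⟩).1 else (e ⟨0, h0⟩).1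
  have hf : ∀ o (h : o < δ.ord), f o = (e ⟨o, h⟩).1 := fun o h => dif_pos h
  let _ : ∀ i, L.Structure {x // x ∈ (f i).carrier} := fun i => (f i).str
  obtain ⟨κ, κ', -, hκκ', hκ'δ, -, -, j, -⟩ := hP.exists_elementaryEmbedding hδ c hc
    (Cardinal.ord_lt_ord.2 (mk_formula_lt hδ hL)) hcγ (fun i => (f i).carrier)
    (fun i hi => by
      rw [hf i hi]; exact hS _ (e ⟨i, hi⟩).2) (fun _ => 0) fun _ _ => h0
  have hκδ := hκκ'.trans hκ'δ
  refine ⟨f κ, by rw [hf κ hκδ]; exact (e _).2, f κ', by rw [hf κ' hκ'δ]; exact (e _).2,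
    fun h => hκκ'.ne ?_, ⟨j⟩⟩
  rw [hf κ hκδ, hf κ' hκ'δ] at h
  exact congrArg Subtype.val (e.injective (Subtype.ext h))

/-! ### Stationarity of the extendible cardinals -/

instance (n : ℕ) : Countable (SetPredRel n) := by
  refine Function.Injective.countable (f := fun _ : SetPredRel n => ()) ?_
  rintro (_ | _) (_ | _) _ <;> rfl

instance : Countable setPredLanguage.Symbols := by
  have h1 : ∀ n, Countable (setPredLanguage.Functions n) := fun n => inferInstanceAs (Countable Empty)
  have h2 : ∀ n, Countable (setPredLanguage.Relations n) := fun n =>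
    inferInstanceAs (Countable (SetPredRel n))
  exact inferInstanceAs (Countable ((Σ n, setPredLanguage.Functions n) ⊕
    (Σ n, setPredLanguage.Relations n)))

theorem HasUnboundedEmbeddings.isStationary {δ : Cardinal.{u}}
    (hP : HasUnboundedEmbeddings δ) (hδ : δ.IsInaccessible) (A : ZFSet.{u}) :
    IsStationary {κ : Set.Iio δ.ord | IsExtendibleBelow δ A κ} := by
  have hlim : Order.IsSuccLimit δ.ord := Cardinal.isSuccLimit_ord hδ.aleph0_lt.le
  intro t ht
  by_contra hempty
  have hfail : ∀ κ : Ordinal.{u}, ∃ lam, κ < δ.ord → κ < lam ∧ lam < δ.ord ∧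
      (κ.IsInitial → ¬ IsExtendibleBelow δ A κ → ∃ hκ : κ < lam, ∀ θ < δ.ord,
        ∀ j : Cut A lam ↪ₑ[setPredLanguage] Cut A θ, HasCriticalPoint j hκ →
          lam.toZFSet ∉ (j (Cut.ord A hκ)).1) := by
    intro κ
    by_cases hκ : κ < δ.ord ∧ κ.IsInitial ∧ ¬ IsExtendibleBelow δ A κ
    · obtain ⟨hκδ, hκi, hext⟩ := hκ
      simp only [IsExtendibleBelow, hκδ, hκi, true_and] at hext
      push Not at hext
      obtain ⟨lam, h1, h2, h3⟩ := hext
      exact ⟨lam, fun _ => ⟨h1, h2, fun _ _ => ⟨h1, h3⟩⟩⟩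
    · exact ⟨Order.succ κ, fun hκδ => ⟨Order.lt_succ κ, hlim.succ_lt hκδ,
        fun hi hext => absurd ⟨hκδ, hi, hext⟩ hκ⟩⟩
  choose f hf using hfail
  have hnext : ∀ η : Ordinal.{u}, ∃ c, η < δ.ord → ∃ hc : c < δ.ord, η < c ∧ ⟨c, hc⟩ ∈ t := by
    intro η
    by_cases hη : η < δ.ord
    · obtain ⟨⟨c, hc⟩, hct, hle⟩ := ht.isCofinal ⟨Order.succ η, hlim.succ_lt hη⟩
      exact ⟨c, fun _ => ⟨hc, (Order.lt_succ η).trans_le hle, hct⟩⟩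
    · exact ⟨0, fun h => absurd h hη⟩
  choose c hc using hnext
  have hcard : ∀ η : Ordinal.{u}, ∃ γ, η < δ.ord → η < γ ∧ γ < δ.ord ∧ γ.IsInitial := by
    intro η
    by_cases hη : η < δ.ord
    · obtain ⟨γ, h1, h2, -, h3, -⟩ := hδ.exists_isOmegaJonsson hη
      exact ⟨γ, fun _ => ⟨h1, h2, h3⟩⟩
    · exact ⟨0, fun h => absurd h hη⟩
  choose s hs using hcard
  obtain ⟨code, hcode⟩ := Countable.exists_injective_nat (Σ n, setPredLanguage.Formula (Fin n))
  let _ : ∀ i, setPredLanguage.Structure {x // x ∈ V_ (f i)} := fun i => Cut.instStructure A (f i)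
  obtain ⟨κ, κ', hκ0, hκκ', hκ'δ, hGκ, hGκ', e, he1, he2⟩ := hP.exists_elementaryEmbedding hδ
    (L := setPredLanguage)
    (fun φ => (code φ : Ordinal.{u})) (Nat.cast_injective.comp hcode) (γ := Ordinal.omega0)
    (by rw [← ord_aleph0]; exact ord_lt_ord.2 hδ.aleph0_lt) (fun φ => Ordinal.natCast_lt_omega0 _)
    (fun i => V_ (f i)) (fun i hi => ZFSet.vonNeumann_mem_of_lt (hf i hi).2.1)
    -- Closure under `c` makes κ a limit of the club, closure under `s` makes it a cardinal, and
    -- closure of κ' under `f` gives f κ < κ'.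
    (fun η => max (f η) (max (c η) (s η)))
    (fun η hη => max_lt (hf η hη).2.1 (max_lt (hc η hη).1 (hs η hη).2.1))
  have hκδ := hκκ'.trans hκ'δ
  have hκt : (⟨κ, hκδ⟩ : Set.Iio δ.ord) ∈ t := by
    have hlt : ∀ η < κ, c η < κ := fun η hη =>
      ((le_max_left _ _).trans (le_max_right _ _)).trans_lt (hGκ η hη)
    refine ht.isLUB_mem (t := {x ∈ t | x.1 < κ}) (fun x hx => hx.1) ?_ ⟨fun x hx => hx.2.le, ?_⟩
    · obtain ⟨h1, h2, h3⟩ := hc 0 (hκ0.trans hκδ)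
      exact ⟨⟨_, h1⟩, h3, hlt 0 hκ0⟩
    · intro b hb
      by_contra hlt'
      have hbκ : b.1 < κ := not_le.1 hlt'
      obtain ⟨h1, h2, h3⟩ := hc b b.2
      exact absurd (hb (show (⟨_, h1⟩ : Set.Iio δ.ord) ∈ _ from ⟨h3, hlt _ hbκ⟩)) (not_le.2 h2)
  have hκi : κ.IsInitial := by
    by_contra hni
    have hlt : κ.card.ord < κ := lt_of_le_of_ne (ord_card_le κ) hni
    obtain ⟨h1, -, h3⟩ := hs _ (hlt.trans hκδ)
    -- The initial ordinal chosen above |κ| lies below κ, so its cardinality is both greater than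
    -- |κ| and at most |κ|.
    have h4 := (h3.card_lt_card).2 h1
    rw [card_ord] at h4
    refine absurd (Ordinal.card_le_card ?_) h4.not_ge
    exact (((le_max_right _ _).trans (le_max_right _ _)).trans_lt (hGκ _ hlt)).le
  have hext : ¬ IsExtendibleBelow δ A κ := fun h => hempty ⟨⟨κ, hκδ⟩, h, hκt⟩
  obtain ⟨hκf, hbad⟩ := (hf κ hκδ).2.2 hκi hext
  let e' : Cut A (f κ) ↪ₑ[setPredLanguage] Cut A (f κ') := e
  have he' : (e' (Cut.ord A hκf)).1 = κ'.toZFSet := he2 _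
  refine hbad (f κ') (hf κ' hκ'δ).2.1 e' ⟨?_, fun β hβ => he1 β hβ _⟩ ?_
  · rw [he']
    exact fun h => hκκ'.ne' (Ordinal.toZFSet_injective h)
  · rw [he']
    exact Ordinal.toZFSet_mem_toZFSet_iff.2 ((le_max_left _ _).trans_lt (hGκ' κ hκκ'))

/-! ### Unbounded embeddings from the Vopěnka property -/

/-- A copy of the language `setPredLanguage` in a higher universe. -/
def liftedSetPredLanguage : FirstOrder.Language.{u, u} :=
  ⟨fun _ => PEmpty, fun n => ULift (setPredLanguage.Relations n)⟩

/-- The translation of `setPredLanguage` into its copy. -/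
def setPredLanguage.lift : setPredLanguage →ᴸ liftedSetPredLanguage.{u} where
  onFunction := fun _ f => nomatch f
  onRelation := fun _ r => ULift.up r

theorem card_liftedSetPredLanguage_le : liftedSetPredLanguage.{u}.card ≤ ℵ₀ := by
  have h1 : ∀ n, Countable (liftedSetPredLanguage.{u}.Functions n) := fun n =>
    inferInstanceAs (Countable PEmpty)
  have h2 : ∀ n, Countable (liftedSetPredLanguage.{u}.Relations n) := fun n =>
    inferInstanceAs (Countable (ULift (SetPredRel n)))
  have : Countable liftedSetPredLanguage.{u}.Symbols :=
    inferInstanceAs (Countable ((Σ n, liftedSetPredLanguage.{u}.Functions n) ⊕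
      (Σ n, liftedSetPredLanguage.{u}.Relations n)))
  exact mk_le_aleph0

instance (A : ZFSet.{u}) (α : Ordinal.{u}) : liftedSetPredLanguage.{u}.Structure (Cut A α) where
  funMap := fun f => nomatch f
  RelMap := fun r x => FirstOrder.Language.Structure.RelMap (L := setPredLanguage) r.down x

instance (A : ZFSet.{u}) (α : Ordinal.{u}) :
    setPredLanguage.lift.{u}.IsExpansionOn (Cut A α) where
  map_onFunction := fun f => nomatch f
  map_onRelation := fun _ _ => rfl

/-- The structure `⟨V_α, ∈, A ∩ V_α⟩` as a set-sized structure. -/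
noncomputable def cutSetStructure (A : ZFSet.{u}) {α : Ordinal.{u}} (hα : 0 < α) :
    SetStructure liftedSetPredLanguage.{u} where
  carrier := V_ α
  nonempty := ⟨∅, by simpa using Ordinal.toZFSet_mem_vonNeumann.2 hα⟩
  str := inferInstanceAs (liftedSetPredLanguage.{u}.Structure (Cut A α))

theorem IsVopenkaCardinal.hasUnboundedEmbeddings {δ : Cardinal.{u}} (h : IsVopenkaCardinal δ) :
    HasUnboundedEmbeddings δ := by
  obtain ⟨hδ, hV⟩ := h
  have hlim : Order.IsSuccLimit δ.ord := Cardinal.isSuccLimit_ord hδ.aleph0_lt.le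
  intro A hA E hE
  let E' : Set Ordinal.{u} := {α | α ∈ E ∧ 0 < α ∧ α < δ.ord}
  have hE' : #E' = Cardinal.lift.{u + 1} δ := by
    refine le_antisymm ?_ (not_lt.1 fun hlt => ?_)
    · have : E' ⊆ Set.Iio δ.ord := fun α hα => hα.2.2
      refine (mk_le_mk_of_subset this).trans ?_
      rw [mk_Iio_ordinal, card_ord]
    -- By regularity, fewer than δ ordinals would be bounded below δ, but E is unbounded.
    · have hsup : sSup E' < δ.ord := Ordinal.sSup_lt_of_lt_cof
        (by rwa [← Ordinal.lift_cof, hδ.isRegular.cof_ord]) fun α hα => hα.2.2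
      obtain ⟨α, hα, hle, hαδ⟩ := hE _ (hlim.succ_lt hsup)
      have hlt' := (Order.lt_succ _).trans_le hle
      exact absurd (le_csSup ⟨δ.ord, fun β hβ => hβ.2.2.le⟩
        (show α ∈ E' from ⟨hα, pos_of_gt hlt', hαδ⟩)) hlt'.not_ge
  let N : E' → SetStructure liftedSetPredLanguage.{u} := fun α => cutSetStructure A α.2.2.1
  have hN : Function.Injective N := fun α β hαβ =>
    Subtype.ext (ZFSet.vonNeumann_injective (congrArg SetStructure.carrier hαβ))
  obtain ⟨_, ⟨⟨α, hα⟩, rfl⟩, _, ⟨⟨β, hβ⟩, rfl⟩, hne, ⟨j⟩⟩ := hV liftedSetPredLanguage.{u}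
    (card_liftedSetPredLanguage_le.trans_lt hδ.aleph0_lt) (Set.range N)
    (by
      rintro _ ⟨α, rfl⟩
      exact ZFSet.vonNeumann_mem_of_lt α.2.2.2)
    (by rw [mk_range_eq N hN, hE'])
  let j' : Cut A α ↪ₑ[liftedSetPredLanguage.{u}] Cut A β := j
  let i : Cut A α ↪ₑ[setPredLanguage] Cut A β := ⟨j', fun n φ x => by
    rw [← setPredLanguage.lift.{u}.realize_onFormula φ, j'.map_formula,
      setPredLanguage.lift.{u}.realize_onFormula φ]⟩
  classical
  have hp : PreservesSets A α β (fun x => if h : x ∈ V_ α then (i ⟨x, h⟩).1 else ∅) :=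
    preservesSets_of_elementary i fun x => dif_pos x.2
  -- Elementary embeddings do not lower ranks, so α ≤ β, and distinct structures have distinct
  -- heights.
  refine ⟨α, hα.1, β, hp.le.lt_of_ne ?_, hβ.2.2, ⟨i⟩⟩
  rintro rfl
  exact hne rfl

theorem theorem2p3 (δ : Cardinal.{u}) (hδ : δ.IsInaccessible) :
    List.TFAE [
      IsVopenkaCardinal δ,
      (∀ A : ZFSet.{u}, A ⊆ V_ δ.ord →
        ∃ lam₀ < δ.ord, ∀ lam : Ordinal.{u}, lam₀ ≤ lam → lam < δ.ord →
          ∃ θ : Ordinal.{u}, lam < θ ∧ θ < δ.ord ∧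
            Nonempty (Cut A lam ↪ₑ[setPredLanguage] Cut A θ)),
      (∀ A : ZFSet.{u}, A ⊆ V_ δ.ord → ∃ κ : Ordinal.{u}, IsExtendibleBelow δ A κ),
      (∀ A : ZFSet.{u}, A ⊆ V_ δ.ord →
        IsStationary {κ : Set.Iio δ.ord | IsExtendibleBelow δ A κ})] := by
  have hlim : Order.IsSuccLimit δ.ord := Cardinal.isSuccLimit_ord hδ.aleph0_lt.le
  tfae_have 1 → 4 := fun h A _ => h.hasUnboundedEmbeddings.isStationary hδ A
  tfae_have 4 → 3 := fun h A hA => by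
    obtain ⟨κ, hκ⟩ := (h A hA).nonempty
    exact ⟨κ.1, hκ⟩
  tfae_have 3 → 2 := fun h A hA => by
    obtain ⟨κ, -, hκδ, hκ⟩ := h A hA
    refine ⟨Order.succ κ, hlim.succ_lt hκδ, fun lam h1 h2 => ?_⟩
    obtain ⟨θ, hθ, j, -, hmem⟩ := hκ lam (Order.succ_le_iff.1 h1) h2
    exact ⟨θ, Ordinal.toZFSet_mem_vonNeumann.1
      (ZFSet.mem_vonNeumann_of_mem hmem (j (Cut.ord A _)).2), hθ, ⟨j⟩⟩
  tfae_have 2 → 1 := fun h => by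
    refine HasUnboundedEmbeddings.isVopenkaCardinal (fun A hA E hE => ?_) hδ
    obtain ⟨lam₀, h0, hlam⟩ := h A hA
    obtain ⟨α, hα, hle, hαδ⟩ := hE lam₀ h0
    exact ⟨α, hα, hlam α hle hαδ⟩
  tfae_finish
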